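/- Let $0<q<1$. For complex $x$ and $n\ge 0$ write $(x;q)_n=\prod_{k=0}^{n-1}(1-xq^k)$, $(x;q)_\infty=\prod_{k\ge 0}(1-xq^k)$, and $(x_1,\dots,x_m;q)_n=(x_1;q)_n\cdots(x_m;q)_n$ (also for $n=\infty$). Let $a,b\in\mathbb C$ satisfy $|ab|<1$ and $q^{2k}a\ne 1$, $q^{2k}b\neq 1$ for all integers $k\ge 1$. Then both series below converge absolutely as series in $n$, and $$\frac{(q^2,ab;q^2)_\infty}{(q^2a,q^2b;q^2)_\infty}\sum_{n=0}^\infty\frac{(q^2/a,q^2/b,q;q^2)_n(ab)^n}{(q^2;q^2)_n(-q;q)_{2n}}=\sum_{n=0}^\infty\sum_{j=-n}^n(-1)^j(1-q^{4n+2})q^{2n^2-j^2}\frac{(q^2/a,q^2/b;q^2)_n(ab)^n}{(q^2a,q^2b;q^2)_n}.$$ Here $a=0$ or $b=0$ is allowed, with $(q^2/a;q^2)_n a^n$ read as $\prod_{k=0}^{n-1}(a-q^{2k+2})$, and likewise for $b$. In particular, for $a=b=0$ (an identity of Andrews), $$\sum_{n=0}^\infty\frac{(q;q^2)_n q^{2n^2+2n}}{(q^2;q^2)_n(-q;q)_{2n}}=\frac1{(q^2;q^2)_\infty}\sum_{n=0}^\infty\sum_{j=-n}^n(-1)^j(1-q^{4n+2})q^{4n^2+2n-j^2},$$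 where both series in $n$ also converge absolutely. -/

import Mathlib

/-- The finite `q`-shifted factorial `(x; q)_n = ∏_{k=0}^{n-1} (1 - x q^k)`. -/
def qPoch (x q : ℂ) (n : ℕ) : ℂ := ∏ k ∈ Finset.range n, (1 - x * q ^ k)

/-- The infinite `q`-shifted factorial `(x; q)_∞ = ∏_{k=0}^∞ (1 - x q^k)`. -/
noncomputable def qPochInf (x q : ℂ) : ℂ := ∏' k : ℕ, (1 - x * q ^ k)

/-- The polynomial `a^n (x/a; q)_n = ∏_{k=0}^{n-1} (a - x q^k)` in `a`, which gives the meaning of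
`a^n (x/a; q)_n` at `a = 0` as well. -/
def powMulQPoch (x a q : ℂ) (n : ℕ) : ℂ := ∏ k ∈ Finset.range n, (a - x * q ^ k)

theorem powMulQPoch_eq (x a q : ℂ) (ha : a ≠ 0) (n : ℕ) :
    powMulQPoch x a q n = a ^ n * qPoch (x / a) q n := by
  unfold powMulQPoch qPoch
  rw [← Finset.card_range n, ← Finset.prod_const, Finset.card_range, ← Finset.prod_mul_distrib]
  refine Finset.prod_congr rfl fun k _ => ?_
  field_simp

theorem multipliable_qPochInf (x q : ℂ) (hq : ‖q‖ < 1) :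
    Multipliable fun k : ℕ => 1 - x * q ^ k := by
  have h : Summable fun k : ℕ => ‖-(x * q ^ k)‖ := by
    simp only [norm_neg, norm_mul, norm_pow]
    exact (summable_geometric_of_lt_one (norm_nonneg q) hq).mul_left _
  simpa [sub_eq_add_neg] using multipliable_one_add_of_summable h

/-! Put p = q². The identity is a Bailey-lemma argument: one absolutely convergent double series,
`baileySummand`, is summed in two ways. Its term at (r, m), with n = r + m, is α_r · a^n b^n (p/a,
p/b; p)_n / ((p; p)_{n-r} (p; p)_{n+r+1}), where α_r = `heckeTerm q r` contains the partial theta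
sum ∑_{|j| ≤ r} (-1)^j q^{-j²}.

For fixed r, the sum over m is a q-Gauss sum (`qGauss_sum`) with both parameters equal to p^{r+1}.
It yields the r-th term of the Hecke-type side together with the infinite products.

For fixed n, the sum over r is finite. Summation by parts collapses it to ∑_{|j| ≤ n} (-1)^j q^{j²}
/ ((p; p)_{n-j} (p; p)_{n+j}), a finite Jacobi triple product at z = -1, whose closed form is (q;
q²)_n / ((q²; q²)_n (-q; q)_{2n}).

The numerators are polynomials in a and b throughout, so a = 0 and b = 0 need no limiting argument.
-/

open Finset Filter Topology

/-! ### Finite q-shifted factorials -/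

theorem qPoch_zero (x q : ℂ) : qPoch x q 0 = 1 := by simp [qPoch]

theorem qPoch_succ (x q : ℂ) (n : ℕ) : qPoch x q (n + 1) = qPoch x q n * (1 - x * q ^ n) := by
  simp [qPoch, prod_range_succ]

theorem powMulQPoch_zero (x a q : ℂ) : powMulQPoch x a q 0 = 1 := by simp [powMulQPoch]

theorem powMulQPoch_succ (x a q : ℂ) (n : ℕ) :
    powMulQPoch x a q (n + 1) = powMulQPoch x a q n * (a - x * q ^ n) := by
  simp [powMulQPoch, prod_range_succ]

theorem qPoch_add (x q : ℂ) (m n : ℕ) :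
    qPoch x q (m + n) = qPoch x q m * qPoch (x * q ^ m) q n := by
  simp only [qPoch, prod_range_add, pow_add, mul_assoc]

theorem powMulQPoch_add (x a q : ℂ) (m n : ℕ) :
    powMulQPoch x a q (m + n) = powMulQPoch x a q m * powMulQPoch (x * q ^ m) a q n := by
  simp only [powMulQPoch, prod_range_add, pow_add, mul_assoc]

theorem one_sub_ne_zero_of_norm_lt_one {z : ℂ} (hz : ‖z‖ < 1) : 1 - z ≠ 0 := by
  intro h
  rw [sub_eq_zero] at h
  simp [← h] at hz

theorem norm_mul_pow_lt_one {x q : ℂ} (hq : ‖q‖ < 1) (hx : ‖x‖ < 1) (k : ℕ) :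
    ‖x * q ^ k‖ < 1 := by
  rw [norm_mul, norm_pow]
  exact mul_lt_one_of_nonneg_of_lt_one_left (norm_nonneg _) hx (pow_le_one₀ (norm_nonneg _) hq.le)

theorem norm_sq_lt_one {q : ℂ} (hq : ‖q‖ < 1) : ‖q ^ 2‖ < 1 := by
  rw [norm_pow]; exact pow_lt_one₀ (norm_nonneg _) hq two_ne_zero

theorem qPoch_ne_zero {x q : ℂ} {n : ℕ} (h : ∀ k, 1 - x * q ^ k ≠ 0) : qPoch x q n ≠ 0 :=
  prod_ne_zero_iff.2 fun k _ => h k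

theorem qPoch_self_succ (q : ℂ) (n : ℕ) : qPoch q q (n + 1) = qPoch q q n * (1 - q ^ (n + 1)) := by
  rw [qPoch_succ, pow_succ' q n]

theorem qPoch_self_ne_zero {q : ℂ} (hq : ‖q‖ < 1) (n : ℕ) : qPoch q q n ≠ 0 :=
  qPoch_ne_zero fun k => one_sub_ne_zero_of_norm_lt_one (norm_mul_pow_lt_one hq hq k)

/-! ### Bailey kernels and their contiguous relations -/

/-- The reciprocal `1 / ((p; p)_{n-j} (p; p)_{n+j+1})`, read as `0` for `j > n`. -/
noncomputable def baileyKernel (p : ℂ) (n j : ℕ) : ℂ :=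
  if j ≤ n then (qPoch p p (n - j) * qPoch p p (n + j + 1))⁻¹ else 0

/-- The reciprocal `1 / ((p; p)_{n-j} (p; p)_{n+j})`, read as `0` for `j > n`. -/
noncomputable def baileyKernelOne (p : ℂ) (n j : ℕ) : ℂ :=
  if j ≤ n then (qPoch p p (n - j) * qPoch p p (n + j))⁻¹ else 0

theorem one_sub_self_pow_ne_zero {p : ℂ} (hp : ‖p‖ < 1) (k : ℕ) : 1 - p ^ (k + 1) ≠ 0 := by
  rw [pow_succ']
  exact one_sub_ne_zero_of_norm_lt_one (norm_mul_pow_lt_one hp hp k)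

theorem baileyKernelOne_eq {p : ℂ} (hp : ‖p‖ < 1) (n j : ℕ) :
    baileyKernelOne p n j = (1 - p ^ (n + j + 1)) * baileyKernel p n j := by
  unfold baileyKernelOne baileyKernel
  split_ifs
  · rw [qPoch_self_succ]
    have := one_sub_self_pow_ne_zero hp (n + j)
    have := qPoch_self_ne_zero hp (n + j)
    have := qPoch_self_ne_zero hp (n - j)
    field_simp
  · simp

/-- At i = 0 the default value 0 of the kernel agrees with the factor 1 - p^0, so the relation
persists at the edge of the support. -/
theorem baileyKernelOne_add_one {p : ℂ} (hp : ‖p‖ < 1) (j i : ℕ) :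
    baileyKernelOne p (j + i) (j + 1) = (1 - p ^ i) * baileyKernel p (j + i) j := by
  unfold baileyKernelOne baileyKernel
  rcases i with _ | i
  · simp
  · rw [if_pos (by omega), if_pos (by omega), show j + (i + 1) - j = i + 1 by omega,
      show j + (i + 1) - (j + 1) = i by omega, qPoch_self_succ, ← add_assoc (j + (i + 1))]
    have := one_sub_self_pow_ne_zero hp i
    have := qPoch_self_ne_zero hp i
    have := qPoch_self_ne_zero hp (j + (i + 1) + j + 1)
    field_simp

theorem baileyKernelOne_succ {p : ℂ} (hp : ‖p‖ < 1) (j i : ℕ) :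
    (1 - p ^ (i + 1)) * baileyKernelOne p (j + i + 1) j = baileyKernel p (j + i) j := by
  unfold baileyKernelOne baileyKernel
  rw [if_pos (by omega), if_pos (by omega), show j + i + 1 - j = i + 1 by omega,
      show j + i - j = i by omega, qPoch_self_succ, show j + i + 1 + j = j + i + j + 1 by ring]
  have := one_sub_self_pow_ne_zero hp i
  have := qPoch_self_ne_zero hp i
  have := qPoch_self_ne_zero hp (j + i + j + 1)
  field_simp

/-! ### The Bailey pair with partial theta numerators -/

/-- The partial theta sum `∑_{|j| ≤ n} (-1)^j q^{-j²}`. -/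
noncomputable def partialTheta (q : ℂ) (n : ℕ) : ℂ :=
  ∑ j ∈ Icc (-(n : ℤ)) (n : ℤ), (-1 : ℂ) ^ j * q ^ (-j ^ 2)

theorem partialTheta_zero (q : ℂ) : partialTheta q 0 = 1 := by simp [partialTheta]

theorem partialTheta_succ (q : ℂ) (n : ℕ) :
    partialTheta q (n + 1) = partialTheta q n + 2 * ((-1) ^ (n + 1) * (q ^ (n + 1) ^ 2)⁻¹) := by
  have h : ((-1 : ℂ)) ^ (-((n : ℤ) + 1)) = (-1) ^ ((n : ℤ) + 1) := by
    rw [zpow_neg, ← inv_zpow]; norm_num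
  have h1 : ((-1 : ℂ)) ^ ((n : ℤ) + 1) = (-1) ^ (n + 1) := by
    exact_mod_cast zpow_natCast (-1 : ℂ) (n + 1)
  have h2 : q ^ (-((n : ℤ) + 1) ^ 2) = (q ^ (n + 1) ^ 2)⁻¹ := by
    rw [zpow_neg]; congr 1
  unfold partialTheta
  push_cast
  rw [Finset.Icc_succ_succ, sum_union, sum_pair (by omega), h, neg_sq, h1, h2]
  · ring
  · rw [disjoint_left]; intro x; simp; omega

/-- Summation by parts turns the Hecke-type sum into a single theta-like sum. -/
theorem sum_baileyKernel_partialTheta {q : ℂ} (hq0 : q ≠ 0) (hq : ‖q ^ 2‖ < 1) (n R : ℕ)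
    (hR : R ≤ n + 1) :
    ∑ r ∈ range R, (1 - (q ^ 2) ^ (2 * r + 1)) * (q ^ 2) ^ r ^ 2 * partialTheta q r
        * baileyKernel (q ^ 2) n r
      = 2 * ∑ j ∈ range R, (-1) ^ j * q ^ j ^ 2 * baileyKernelOne (q ^ 2) n j
        - baileyKernelOne (q ^ 2) n 0
        - (q ^ 2) ^ R ^ 2 * baileyKernelOne (q ^ 2) n R
          * (partialTheta q R - 2 * ((-1) ^ R * (q ^ R ^ 2)⁻¹)) := by
  induction R with
  | zero => simp [partialTheta_zero]; ring
  | succ r ih =>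
    rw [sum_range_succ, sum_range_succ, ih (by omega), partialTheta_succ]
    obtain ⟨i, rfl⟩ : ∃ i, n = r + i := ⟨n - r, by omega⟩
    -- With K and K₁ the two kernels, these relations give (1 - p^{2r+1}) p^{r²} K(n,r) = p^{r²}
    -- K₁(n,r) - p^{(r+1)²} K₁(n,r+1), the difference that drives the summation by parts.
    rw [baileyKernelOne_add_one hq, baileyKernelOne_eq hq _ r]
    have hr : q ^ r ^ 2 ≠ 0 := pow_ne_zero _ hq0
    field_simp
    ring

theorem baileyKernelOne_succ_succ {p : ℂ} (hp : ‖p‖ < 1) {n j : ℕ} (h : j ≤ n) :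
    (1 - p ^ (n + j + 2)) * baileyKernelOne p (n + 1) (j + 1) = baileyKernel p n j := by
  unfold baileyKernelOne baileyKernel
  rw [if_pos (by omega), if_pos h, show n + 1 - (j + 1) = n - j by omega,
    show n + 1 + (j + 1) = n + j + 1 + 1 by ring, qPoch_self_succ p (n + j + 1)]
  have := one_sub_self_pow_ne_zero hp (n + j + 1)
  have := qPoch_self_ne_zero hp (n - j)
  have := qPoch_self_ne_zero hp (n + j + 1)
  field_simp

/-- Telescoped one-sided form of the recurrence in `n` for the finite Jacobi triple product. -/
theorem sum_baileyKernelOne_recurrence {q : ℂ} (hq : ‖q ^ 2‖ < 1) (n R : ℕ) (hR : R ≤ n + 1) :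
    (1 - (q ^ (2 * n + 1)) ^ 2) * (1 - (q ^ (2 * n + 1)) ^ 2 * q ^ 2)
        * (2 * ∑ j ∈ range (R + 1), (-1) ^ j * q ^ j ^ 2 * baileyKernelOne (q ^ 2) (n + 1) j
            - baileyKernelOne (q ^ 2) (n + 1) 0)
      - (1 - q ^ (2 * n + 1)) ^ 2
        * (2 * ∑ j ∈ range (R + 1), (-1) ^ j * q ^ j ^ 2 * baileyKernelOne (q ^ 2) n j
            - baileyKernelOne (q ^ 2) n 0)
      = 2 * q ^ (2 * n + 1) * (1 - q ^ (2 * n + 1)) * (-1) ^ R * (q ^ (R + 1) ^ 2 + q ^ R ^ 2)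
        * baileyKernel (q ^ 2) n R := by
  induction R with
  | zero =>
    have h1 := baileyKernelOne_succ hq 0 n
    have h2 := baileyKernelOne_eq hq n 0
    simp only [zero_add, add_zero] at h1 h2
    simp only [zero_add, sum_range_one, h2, ← h1]
    ring
  | succ R ih =>
    obtain ⟨i, rfl⟩ : ∃ i, n = R + i := ⟨n - R, by omega⟩
    have h0 := baileyKernelOne_succ_succ hq (show R ≤ R + i by omega)
    have h1 := baileyKernelOne_add_one hq R i
    have h2 := baileyKernelOne_eq hq (R + i) (R + 1)
    -- All kernels in the induction step become multiples of the single value at (n + 1, R + 1),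
    -- which leaves a polynomial identity. For i = 0 both sides vanish.
    have h3 : baileyKernel (q ^ 2) (R + i) (R + 1)
        = (1 - (q ^ 2) ^ i) * baileyKernelOne (q ^ 2) (R + i + 1) (R + 1) := by
      refine mul_left_cancel₀ (one_sub_self_pow_ne_zero hq (R + i + R + 1)) ?_
      rw [show R + i + R + 1 + 1 = R + i + (R + 1) + 1 by ring, ← h2, h1, ← h0]
      ring
    have ih := ih (by omega)
    rw [← h0] at h1 ih
    rw [sum_range_succ _ (R + 1), sum_range_succ _ (R + 1), h1, h3]
    linear_combination ih

/-- The one-sided form of `∑_{|j| ≤ n} (-1)^j q^{j²} / ((q²; q²)_{n-j} (q²; q²)_{n+j})`. -/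
theorem two_mul_sum_baileyKernelOne_sub {q : ℂ} (hq : ‖q‖ < 1) (n : ℕ) :
    2 * ∑ j ∈ range (n + 1), (-1) ^ j * q ^ j ^ 2 * baileyKernelOne (q ^ 2) n j
        - baileyKernelOne (q ^ 2) n 0
      = qPoch q (q ^ 2) n / (qPoch (q ^ 2) (q ^ 2) n * qPoch (-q) q (2 * n)) := by
  have hq2 := norm_sq_lt_one hq
  induction n with
  | zero => simp [baileyKernelOne, qPoch_zero]; norm_num
  | succ n ih =>
    -- At R = n + 1 the telescoped right side vanishes, leaving a first-order recurrence in n for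
    -- the full sum.
    have h := sum_baileyKernelOne_recurrence hq2 n (n + 1) le_rfl
    have h0 : baileyKernel (q ^ 2) n (n + 1) = 0 := by simp [baileyKernel]
    have h1 : baileyKernelOne (q ^ 2) n (n + 1) = 0 := by simp [baileyKernelOne]
    rw [sum_range_succ (fun j => (-1) ^ j * q ^ j ^ 2 * baileyKernelOne (q ^ 2) n j), h0, h1,
      mul_zero, mul_zero, add_zero, ih] at h
    have ha := one_sub_self_pow_ne_zero hq2 n
    have hb := one_sub_self_pow_ne_zero hq (2 * n)
    have hc : 1 + q ^ (2 * n + 1) ≠ 0 := by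
      have := one_sub_ne_zero_of_norm_lt_one (norm_mul_pow_lt_one hq (x := -q) (by simpa) (2 * n))
      rwa [neg_mul, sub_neg_eq_add, ← pow_succ'] at this
    have hd : 1 + q ^ (2 * n + 2) ≠ 0 := by
      have := one_sub_ne_zero_of_norm_lt_one (norm_mul_pow_lt_one hq (x := -q) (by simpa) (2 * n + 1))
      rwa [neg_mul, sub_neg_eq_add, ← pow_succ'] at this
    have he : qPoch (-q) q (2 * n) ≠ 0 := qPoch_ne_zero fun k =>
      one_sub_ne_zero_of_norm_lt_one (norm_mul_pow_lt_one hq (by simpa) k)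
    have hf := qPoch_self_ne_zero hq2 n
    have hA : (1 - (q ^ (2 * n + 1)) ^ 2) * (1 - (q ^ (2 * n + 1)) ^ 2 * q ^ 2) ≠ 0 := by
      have : (1 - (q ^ (2 * n + 1)) ^ 2) * (1 - (q ^ (2 * n + 1)) ^ 2 * q ^ 2)
        = (1 - q ^ (2 * n + 1)) * (1 + q ^ (2 * n + 1)) * (1 - (q ^ 2) ^ (n + 1))
          * (1 + q ^ (2 * n + 2)) := by ring
      rw [this]
      exact mul_ne_zero (mul_ne_zero (mul_ne_zero hb hc) ha) hd
    refine mul_left_cancel₀ hA ((sub_eq_zero.1 h).trans ?_)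
    rw [qPoch_succ, qPoch_self_succ, show 2 * (n + 1) = 2 * n + 1 + 1 by ring, qPoch_succ,
      qPoch_succ, show 1 - -q * q ^ (2 * n) = 1 + q ^ (2 * n + 1) by ring,
      show 1 - -q * q ^ (2 * n + 1) = 1 + q ^ (2 * n + 2) by ring,
      show 1 - q * (q ^ 2) ^ n = 1 - q ^ (2 * n + 1) by ring]
    field_simp
    ring

/-- Taking R = n + 1 in the summation by parts kills the boundary term, since the kernel vanishes
beyond j = n. -/
theorem sum_partialTheta_mul_baileyKernel {q : ℂ} (hq0 : q ≠ 0) (hq : ‖q‖ < 1) (n : ℕ) :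
    ∑ r ∈ range (n + 1), (1 - (q ^ 2) ^ (2 * r + 1)) * (q ^ 2) ^ r ^ 2 * partialTheta q r
        * baileyKernel (q ^ 2) n r
      = qPoch q (q ^ 2) n / (qPoch (q ^ 2) (q ^ 2) n * qPoch (-q) q (2 * n)) := by
  have hq2 := norm_sq_lt_one hq
  have h1 : baileyKernelOne (q ^ 2) n (n + 1) = 0 := by simp [baileyKernelOne]
  rw [sum_baileyKernel_partialTheta hq0 hq2 n (n + 1) le_rfl, h1,
    ← two_mul_sum_baileyKernelOne_sub hq]
  ring

/-! ### Infinite products and a ratio test -/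

theorem tendsto_qPoch {p : ℂ} (hp : ‖p‖ < 1) (x : ℂ) :
    Tendsto (qPoch x p) atTop (𝓝 (qPochInf x p)) :=
  (multipliable_qPochInf x p hp).tendsto_prod_tprod_nat

theorem qPochInf_ne_zero {x p : ℂ} (hp : ‖p‖ < 1) (h : ∀ k, 1 - x * p ^ k ≠ 0) :
    qPochInf x p ≠ 0 := by
  unfold qPochInf
  simp only [sub_eq_add_neg] at h ⊢
  refine tprod_one_add_ne_zero_of_summable h ?_
  simp only [norm_neg, norm_mul, norm_pow]
  exact (summable_geometric_of_lt_one (norm_nonneg p) hp).mul_left _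

theorem qPochInf_zero (p : ℂ) : qPochInf 0 p = 1 := by simp [qPochInf]

theorem qPoch_mul_qPochInf {p : ℂ} (hp : ‖p‖ < 1) (x : ℂ) (n : ℕ) :
    qPoch x p n * qPochInf (x * p ^ n) p = qPochInf x p := by
  have h1 := (tendsto_qPoch hp (x * p ^ n)).const_mul (qPoch x p n)
  have h2 : Tendsto (fun m => qPoch x p (n + m)) atTop (𝓝 (qPochInf x p)) := by
    simpa only [add_comm n] using (tendsto_add_atTop_iff_nat n).2 (tendsto_qPoch hp x)
  simp only [← qPoch_add] at h1
  exact tendsto_nhds_unique h1 h2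

theorem tendsto_mul_pow_zero {p : ℂ} (hp : ‖p‖ < 1) (x : ℂ) :
    Tendsto (fun k : ℕ => x * p ^ k) atTop (𝓝 0) := by
  simpa using (tendsto_pow_atTop_nhds_zero_of_norm_lt_one hp).const_mul x

/-- A ratio test without quotients: terms may vanish, as they do when a numerator such as (x/a; p)_n
terminates. -/
theorem summable_of_norm_succ_le {E : Type*} [SeminormedAddCommGroup E] [CompleteSpace E]
    {f : ℕ → E} {c : ℕ → ℝ} {l : ℝ} (hl : l < 1) (hc : Tendsto c atTop (𝓝 l))
    (h : ∀ n, ‖f (n + 1)‖ ≤ c n * ‖f n‖) : Summable f := by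
  obtain ⟨r, hlr, hr⟩ := exists_between hl
  refine summable_of_ratio_norm_eventually_le hr ?_
  filter_upwards [hc.eventually_lt_const hlr] with n hn
  exact (h n).trans (mul_le_mul_of_nonneg_right hn.le (norm_nonneg _))

/-! ### The q-Gauss sum -/

/-- The general term of the `q`-Gauss sum. -/
noncomputable def qGaussTerm (x y a b p : ℂ) (m : ℕ) : ℂ :=
  powMulQPoch x a p m * powMulQPoch y b p m / (qPoch p p m * qPoch (x * y) p m)

/-- A majorant of the terms of the `q`-Gauss sum. -/
noncomputable def qGaussMajorant (X Y A B : ℝ) (p : ℂ) (δ : ℕ → ℝ) (m : ℕ) : ℝ :=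
  ∏ k ∈ range m, (A + X * ‖p‖ ^ k) * (B + Y * ‖p‖ ^ k) / (‖1 - p * p ^ k‖ * δ k)

theorem qGaussTerm_comm (x y a b p : ℂ) : qGaussTerm x y a b p = qGaussTerm y x b a p := by
  funext m
  unfold qGaussTerm
  rw [mul_comm x y, mul_comm (powMulQPoch x a p m)]

theorem qGaussTerm_zero (x y a b p : ℂ) : qGaussTerm x y a b p 0 = 1 := by
  simp [qGaussTerm, qPoch_zero, powMulQPoch_zero]

theorem norm_qGaussTerm_le {x y a b p : ℂ} {X Y A B : ℝ} {δ : ℕ → ℝ} (hp : ‖p‖ < 1)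
    (hx : ‖x‖ ≤ X) (hy : ‖y‖ ≤ Y) (ha : ‖a‖ ≤ A) (hb : ‖b‖ ≤ B)
    (hδ : ∀ k, 0 < δ k) (hδ' : ∀ k, δ k ≤ ‖1 - x * y * p ^ k‖) (m : ℕ) :
    ‖qGaussTerm x y a b p m‖ ≤ qGaussMajorant X Y A B p δ m := by
  have key : ∀ {x a : ℂ} {X A : ℝ}, ‖x‖ ≤ X → ‖a‖ ≤ A → ∀ k : ℕ,
      ‖a - x * p ^ k‖ ≤ A + X * ‖p‖ ^ k := fun hx ha k => by
    refine (norm_sub_le _ _).trans (add_le_add ha ?_)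
    rw [norm_mul, norm_pow]
    exact mul_le_mul_of_nonneg_right hx (by positivity)
  unfold qGaussTerm qGaussMajorant powMulQPoch qPoch
  rw [← prod_mul_distrib, ← prod_mul_distrib, ← prod_div_distrib, norm_prod]
  refine prod_le_prod (fun _ _ => norm_nonneg _) fun k _ => ?_
  rw [norm_div, norm_mul, norm_mul]
  have h1 : 0 < ‖1 - p * p ^ k‖ :=
    norm_pos_iff.2 (one_sub_ne_zero_of_norm_lt_one (norm_mul_pow_lt_one hp hp k))
  have h2 := hδ k
  have h3 := key hx ha k
  have h4 := key hy hb k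
  exact div_le_div₀ (mul_nonneg ((norm_nonneg _).trans h3) ((norm_nonneg _).trans h4))
    (mul_le_mul h3 h4 (norm_nonneg _) ((norm_nonneg _).trans h3)) (mul_pos h1 h2)
    (mul_le_mul_of_nonneg_left (hδ' k) h1.le)

theorem summable_qGaussMajorant {X Y A B : ℝ} {p : ℂ} {δ : ℕ → ℝ} (hp : ‖p‖ < 1)
    (hAB : A * B < 1) (hX : 0 ≤ X) (hY : 0 ≤ Y) (hA : 0 ≤ A) (hB : 0 ≤ B)
    (hδ : ∀ k, 0 < δ k) (hδ1 : Tendsto δ atTop (𝓝 1)) :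
    Summable (qGaussMajorant X Y A B p δ) := by
  have hpow := tendsto_pow_atTop_nhds_zero_of_lt_one (norm_nonneg p) hp
  have h1 : Tendsto (fun k => (A + X * ‖p‖ ^ k) * (B + Y * ‖p‖ ^ k) / (‖1 - p * p ^ k‖ * δ k))
      atTop (𝓝 (A * B)) := by
    have := (((hpow.const_mul X).const_add A).mul ((hpow.const_mul Y).const_add B)).div
      ((((tendsto_mul_pow_zero hp p).const_sub 1).norm).mul hδ1) (by simp)
    simpa [Pi.div_def] using this
  refine summable_of_norm_succ_le hAB h1 fun n => ?_
  rw [qGaussMajorant, prod_range_succ, norm_mul, mul_comm]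
  refine le_of_eq (congrArg₂ _ (Real.norm_of_nonneg ?_) rfl)
  have := hδ n
  positivity

theorem summable_qGaussTerm {x y a b p : ℂ} (hp : ‖p‖ < 1) (hab : ‖a * b‖ < 1)
    (hxy : ∀ k, 1 - x * y * p ^ k ≠ 0) : Summable (qGaussTerm x y a b p) := by
  have hδ : ∀ k, 0 < ‖1 - x * y * p ^ k‖ := fun k => norm_pos_iff.2 (hxy k)
  refine .of_norm_bounded (summable_qGaussMajorant (δ := fun k => ‖1 - x * y * p ^ k‖) hp
    (by rwa [norm_mul] at hab) (norm_nonneg x) (norm_nonneg y) (norm_nonneg a) (norm_nonneg b) hδ ?_)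
    (norm_qGaussTerm_le hp le_rfl le_rfl le_rfl le_rfl hδ fun _ => le_rfl)
  simpa using ((tendsto_mul_pow_zero hp (x * y)).const_sub 1).norm

/-- Replacing a by ap shifts the product by one index, so the shifted q-Gauss term is comparable
with the preceding unshifted one. -/
theorem powMulQPoch_mul_base_succ (x a p : ℂ) (n : ℕ) :
    powMulQPoch x (a * p) p (n + 1) = p ^ n * (a * p - x) * powMulQPoch x a p n := by
  induction n with
  | zero => simp [powMulQPoch]
  | succ n ih => rw [powMulQPoch_succ, ih, powMulQPoch_succ]; ring

/-- The right side is the telescoping certificate for the relation between a and ap; it tends to 0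
with the terms, so only the two full sums survive in the limit. -/
theorem sum_qGaussTerm_contiguous {x y a b p : ℂ} (hp : ‖p‖ < 1)
    (hxy : ∀ k, 1 - x * y * p ^ k ≠ 0) (n : ℕ) :
    (1 - a * b) * ∑ m ∈ range (n + 1), qGaussTerm x y a b p m
        - (1 - y * a) * ∑ m ∈ range (n + 1), qGaussTerm x y (a * p) b p m
      = -a * (b - y * p ^ n) * qGaussTerm x y a b p n := by
  induction n with
  | zero => simp [qGaussTerm_zero]; ring
  | succ n ih =>
    rw [sum_range_succ _ (n + 1), sum_range_succ _ (n + 1), mul_add, mul_add, add_sub_add_comm, ih]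
    have h3 := one_sub_ne_zero_of_norm_lt_one (norm_mul_pow_lt_one hp hp n)
    have e : qPoch p p (n + 1) * qPoch (x * y) p (n + 1)
        = (1 - p * p ^ n) * (1 - x * y * p ^ n) * (qPoch p p n * qPoch (x * y) p n) := by
      rw [qPoch_succ, qPoch_succ]; ring
    have hD := mul_ne_zero h3 (hxy n)
    have h1 : (1 - p * p ^ n) * (1 - x * y * p ^ n) * qGaussTerm x y a b p (n + 1)
        = (a - x * p ^ n) * (b - y * p ^ n) * qGaussTerm x y a b p n := by
      unfold qGaussTerm
      rw [e, powMulQPoch_succ, powMulQPoch_succ, ← mul_div_assoc, mul_div_mul_left _ _ hD]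
      ring
    have h2 : (1 - p * p ^ n) * (1 - x * y * p ^ n) * qGaussTerm x y (a * p) b p (n + 1)
        = p ^ n * (a * p - x) * (b - y * p ^ n) * qGaussTerm x y a b p n := by
      unfold qGaussTerm
      rw [e, powMulQPoch_mul_base_succ, powMulQPoch_succ, ← mul_div_assoc,
        mul_div_mul_left _ _ hD]
      ring
    refine mul_left_cancel₀ hD ?_
    linear_combination (1 - a * b + a * (b - y * p ^ (n + 1))) * h1 - (1 - y * a) * h2

theorem tsum_qGaussTerm_contiguous {x y a b p : ℂ} (hp : ‖p‖ < 1) (hab : ‖a * b‖ < 1)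
    (hxy : ∀ k, 1 - x * y * p ^ k ≠ 0) :
    (1 - a * b) * ∑' m, qGaussTerm x y a b p m
      = (1 - y * a) * ∑' m, qGaussTerm x y (a * p) b p m := by
  have hab' : ‖a * p * b‖ < 1 := by
    simpa [mul_right_comm] using norm_mul_pow_lt_one hp hab 1
  have h1 := summable_qGaussTerm hp hab hxy
  have h2 := summable_qGaussTerm hp hab' hxy
  have h3 := ((h1.tendsto_sum_tsum_nat.comp (tendsto_add_atTop_nat 1)).const_mul (1 - a * b)).sub
    ((h2.tendsto_sum_tsum_nat.comp (tendsto_add_atTop_nat 1)).const_mul (1 - y * a))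
  have h4 : Tendsto (fun n => -a * (b - y * p ^ n) * qGaussTerm x y a b p n) atTop (𝓝 0) := by
    simpa using (((tendsto_mul_pow_zero hp y).const_sub b).const_mul (-a)).mul
      h1.tendsto_atTop_zero
  refine sub_eq_zero.1 (tendsto_nhds_unique (h3.congr fun n => ?_) h4)
  exact sum_qGaussTerm_contiguous hp hxy n

theorem qPoch_mul_tsum_qGaussTerm {x y a b p : ℂ} (hp : ‖p‖ < 1) (hab : ‖a * b‖ < 1)
    (hxy : ∀ k, 1 - x * y * p ^ k ≠ 0) (n : ℕ) :
    qPoch (a * b) p n * ∑' m, qGaussTerm x y a b p m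
      = qPoch (y * a) p n * ∑' m, qGaussTerm x y (a * p ^ n) b p m := by
  induction n with
  | zero => simp [qPoch_zero]
  | succ n ih =>
    have h := tsum_qGaussTerm_contiguous (a := a * p ^ n) (b := b) hp
      (by simpa [mul_right_comm] using norm_mul_pow_lt_one hp hab n) hxy
    rw [mul_assoc a (p ^ n) p, ← pow_succ] at h
    rw [qPoch_succ, qPoch_succ]
    linear_combination (1 - a * b * p ^ n) * ih + qPoch (y * a) p n * h

/-- Iterating the contiguous relation drives a through ap^n to 0. Since |ap^n| ≤ |a|, one majorant
serves every n and dominated convergence applies. -/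
theorem qPochInf_mul_tsum_qGaussTerm_zero {x y a b p : ℂ} (hp : ‖p‖ < 1) (hab : ‖a * b‖ < 1)
    (hxy : ∀ k, 1 - x * y * p ^ k ≠ 0) :
    qPochInf (a * b) p * ∑' m, qGaussTerm x y a b p m
      = qPochInf (y * a) p * ∑' m, qGaussTerm x y 0 b p m := by
  have hδ : ∀ k, 0 < ‖1 - x * y * p ^ k‖ := fun k => norm_pos_iff.2 (hxy k)
  have hs : Summable (qGaussMajorant ‖x‖ ‖y‖ ‖a‖ ‖b‖ p fun k => ‖1 - x * y * p ^ k‖) :=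
    summable_qGaussMajorant hp (by rwa [norm_mul] at hab) (norm_nonneg _) (norm_nonneg _)
      (norm_nonneg _) (norm_nonneg _) hδ
      (by simpa using ((tendsto_mul_pow_zero hp (x * y)).const_sub 1).norm)
  have hlim : Tendsto (fun n : ℕ => ∑' m, qGaussTerm x y (a * p ^ n) b p m) atTop
      (𝓝 (∑' m, qGaussTerm x y 0 b p m)) := by
    refine tendsto_tsum_of_dominated_convergence hs (fun m => ?_) (.of_forall fun n m => ?_)
    · have hc : Continuous fun a => qGaussTerm x y a b p m := by
        unfold qGaussTerm powMulQPoch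
        fun_prop
      exact (hc.tendsto 0).comp (tendsto_mul_pow_zero hp a)
    · refine norm_qGaussTerm_le hp le_rfl le_rfl ?_ le_rfl hδ (fun _ => le_rfl) m
      rw [norm_mul, norm_pow]
      exact mul_le_of_le_one_right (norm_nonneg _) (pow_le_one₀ (norm_nonneg _) hp.le)
  refine tendsto_nhds_unique ((tendsto_qPoch hp (a * b)).mul_const _)
    (((tendsto_qPoch hp (y * a)).mul hlim).congr fun n => ?_)
  exact (qPoch_mul_tsum_qGaussTerm hp hab hxy n).symm

/-- The `q`-Gauss sum. -/
theorem qGauss_sum {x y a b p : ℂ} (hp : ‖p‖ < 1) (hab : ‖a * b‖ < 1)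
    (hxy : ∀ k, 1 - x * y * p ^ k ≠ 0) :
    qPochInf (x * y) p * qPochInf (a * b) p * ∑' m, qGaussTerm x y a b p m
      = qPochInf (y * a) p * qPochInf (x * b) p := by
  have hyx : ∀ k, 1 - y * x * p ^ k ≠ 0 := by simpa only [mul_comm y x] using hxy
  have h1 := qPochInf_mul_tsum_qGaussTerm_zero hp hab hxy
  have h2 := qPochInf_mul_tsum_qGaussTerm_zero (a := b) (b := 0) hp (by simp) hyx
  -- The sum with both a and b equal to 0 is found by running the reduction from a = y, where the
  -- factor y - y truncates the series to its first term.
  have h3 := qPochInf_mul_tsum_qGaussTerm_zero (a := y) (b := 0) hp (by simp) hyx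
  have h4 : ∑' m, qGaussTerm y x y 0 p m = 1 := by
    rw [tsum_eq_single 0, qGaussTerm_zero]
    intro m hm
    obtain ⟨m, rfl⟩ := Nat.exists_eq_succ_of_ne_zero hm
    simp [qGaussTerm, powMulQPoch, prod_range_succ']
  rw [mul_zero, qPochInf_zero, one_mul] at h2 h3
  rw [h4] at h3
  rw [qGaussTerm_comm x y 0 b, h2] at h1
  linear_combination qPochInf (x * y) p * h1 - qPochInf (y * a) p * qPochInf (x * b) p * h3

/-! ### Absolute convergence of the double series -/

theorem Summable.hasSum_sum_antidiagonal {f : ℕ × ℕ → ℂ} (hf : Summable f) :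
    HasSum (fun n => ∑ x ∈ antidiagonal n, f x) (∑' x, f x) := by
  have h := (HasAntidiagonal.sigmaAntidiagonalEquivProd (A := ℕ)).hasSum_iff.2 hf.hasSum
  exact h.sigma fun n => (antidiagonal n).hasSum f

/-- Passing from n to n + 1 multiplies the normalised sum by q^{2n+1}, of norm at most 1, and adds
±2. -/
theorem norm_pow_sq_mul_partialTheta_le {q : ℂ} (hq0 : q ≠ 0) (hq : ‖q‖ < 1) (n : ℕ) :
    ‖q ^ n ^ 2 * partialTheta q n‖ ≤ 2 * n + 1 := by
  induction n with
  | zero => simp [partialTheta_zero]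
  | succ n ih =>
    have h0 : q ^ (n + 1) ^ 2 ≠ 0 := pow_ne_zero _ hq0
    have h : q ^ (n + 1) ^ 2 * partialTheta q (n + 1)
        = q ^ (2 * n + 1) * (q ^ n ^ 2 * partialTheta q n) + 2 * (-1) ^ (n + 1) := by
      rw [partialTheta_succ]
      field_simp
      ring
    rw [h]
    refine (norm_add_le _ _).trans ?_
    have h1 : ‖q ^ (2 * n + 1)‖ ≤ 1 := by
      rw [norm_pow]; exact pow_le_one₀ (norm_nonneg _) hq.le
    rw [norm_mul]
    have h2 := mul_le_of_le_one_left (norm_nonneg (q ^ n ^ 2 * partialTheta q n)) h1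
    have h3 : ‖(2 : ℂ) * (-1) ^ (n + 1)‖ = 2 := by simp
    push_cast
    linarith

/-- The numerators of the Bailey pair attached to the partial theta sums. -/
noncomputable def heckeTerm (q : ℂ) (r : ℕ) : ℂ :=
  (1 - (q ^ 2) ^ (2 * r + 1)) * (q ^ 2) ^ r ^ 2 * partialTheta q r

theorem summable_norm_heckeTerm {q : ℂ} (hq0 : q ≠ 0) (hq : ‖q‖ < 1) :
    Summable fun r => ‖heckeTerm q r‖ := by
  have hs : Summable fun r : ℕ => 2 * ((2 * (r : ℝ) + 1) * ‖q‖ ^ r) := by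
    have h1 := summable_pow_mul_geometric_of_norm_lt_one 1 (r := ‖q‖) (by simpa)
    have h0 := summable_geometric_of_lt_one (norm_nonneg q) hq
    exact (((h1.mul_left 2).add h0).mul_left 2).congr fun r => by simp only [pow_one]; ring
  refine .of_nonneg_of_le (fun _ => norm_nonneg _) (fun r => ?_) hs
  -- Of the two factors q^{r²} in p^{r²}, one tames the partial theta sum and the other supplies the
  -- decay.
  have h : heckeTerm q r
      = (1 - (q ^ 2) ^ (2 * r + 1)) * ((q ^ r ^ 2 * partialTheta q r) * q ^ r ^ 2) := by
    unfold heckeTerm; ring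
  rw [h, norm_mul, norm_mul (q ^ r ^ 2 * _)]
  have h1 : ‖1 - (q ^ 2) ^ (2 * r + 1)‖ ≤ 2 := by
    refine (norm_sub_le _ _).trans ?_
    rw [norm_one, norm_pow, norm_pow]
    linarith [pow_le_one₀ (n := 2 * r + 1) (by positivity : 0 ≤ ‖q‖ ^ 2)
      (pow_le_one₀ (norm_nonneg q) hq.le)]
  have h2 : ‖q ^ r ^ 2‖ ≤ ‖q‖ ^ r := by
    rw [norm_pow]
    exact pow_le_pow_of_le_one (norm_nonneg _) hq.le (Nat.le_self_pow two_ne_zero r)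
  exact mul_le_mul h1 (mul_le_mul (norm_pow_sq_mul_partialTheta_le hq0 hq r) h2 (norm_nonneg _)
    (by positivity)) (by positivity) (by positivity)

/-- The ratio of consecutive products tends to ab, which has norm less than 1. -/
theorem tendsto_powMulQPoch_mul_zero {p a b : ℂ} (hp : ‖p‖ < 1) (hab : ‖a * b‖ < 1) (x y : ℂ) :
    Tendsto (fun n => powMulQPoch x a p n * powMulQPoch y b p n) atTop (𝓝 0) := by
  have h := ((((tendsto_mul_pow_zero hp x).const_sub a).mul
    ((tendsto_mul_pow_zero hp y).const_sub b))).norm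
  refine (summable_of_norm_succ_le (by simpa using hab) h fun n => le_of_eq ?_).tendsto_atTop_zero
  rw [powMulQPoch_succ, powMulQPoch_succ, ← norm_mul]
  congr 1
  ring

/-- The summand of the double series behind the transformation formula. -/
noncomputable def baileySummand (q a b : ℂ) (x : ℕ × ℕ) : ℂ :=
  heckeTerm q x.1 * (powMulQPoch (q ^ 2) a (q ^ 2) (x.1 + x.2)
    * powMulQPoch (q ^ 2) b (q ^ 2) (x.1 + x.2)) * baileyKernel (q ^ 2) (x.1 + x.2) x.1

theorem baileySummand_eq (q a b : ℂ) (r m : ℕ) :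
    baileySummand q a b (r, m)
      = heckeTerm q r * (powMulQPoch (q ^ 2) a (q ^ 2) r * powMulQPoch (q ^ 2) b (q ^ 2) r
          * (qPoch (q ^ 2) (q ^ 2) (2 * r + 1))⁻¹)
        * qGaussTerm (q ^ 2 * (q ^ 2) ^ r) (q ^ 2 * (q ^ 2) ^ r) a b (q ^ 2) m := by
  have h : r + m + r + 1 = (2 * r + 1) + m := by ring
  unfold baileySummand baileyKernel qGaussTerm
  rw [if_pos (Nat.le_add_right r m), Nat.add_sub_cancel_left, h, powMulQPoch_add,
    powMulQPoch_add, qPoch_add _ _ (2 * r + 1),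
    show q ^ 2 * (q ^ 2) ^ r * (q ^ 2 * (q ^ 2) ^ r) = q ^ 2 * (q ^ 2) ^ (2 * r + 1) by ring,
    div_eq_mul_inv]
  simp only [mul_inv]
  ring

theorem summable_heckeTerm_mul {q a b : ℂ} (hq0 : q ≠ 0) (hq : ‖q‖ < 1) (hab : ‖a * b‖ < 1)
    {g : ℕ → ℂ} {c : ℂ} (hg : Tendsto g atTop (𝓝 c)) :
    Summable fun r => heckeTerm q r
      * (powMulQPoch (q ^ 2) a (q ^ 2) r * powMulQPoch (q ^ 2) b (q ^ 2) r * g r) :=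
  (summable_norm_heckeTerm hq0 hq).mul_tendsto_const (by
    rw [Nat.cofinite_eq_atTop]
    exact (tendsto_powMulQPoch_mul_zero (norm_sq_lt_one hq) hab _ _).mul hg)

/-- The term factors as a function of r times a q-Gauss term. The latter has a majorant in m alone,
uniform in r, so a product of two convergent series dominates. -/
theorem summable_baileySummand {q a b : ℂ} (hq0 : q ≠ 0) (hq : ‖q‖ < 1) (hab : ‖a * b‖ < 1) :
    Summable (baileySummand q a b) := by
  have hp := norm_sq_lt_one hq
  have hp0 : qPochInf (q ^ 2) (q ^ 2) ≠ 0 := qPochInf_ne_zero hp fun k =>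
    one_sub_ne_zero_of_norm_lt_one (norm_mul_pow_lt_one hp hp k)
  have hg : Tendsto (fun r => (qPoch (q ^ 2) (q ^ 2) (2 * r + 1))⁻¹) atTop
      (𝓝 (qPochInf (q ^ 2) (q ^ 2))⁻¹) :=
    ((tendsto_qPoch hp _).comp
      (tendsto_atTop_mono (fun r => show r ≤ 2 * r + 1 by omega) tendsto_id)).inv₀ hp0
  have hu := (summable_heckeTerm_mul hq0 hq hab hg).norm
  have hδ : ∀ k : ℕ, 0 < 1 - ‖q ^ 2‖ ^ (k + 1) := fun k =>
    sub_pos.2 (pow_lt_one₀ (norm_nonneg _) hp k.succ_ne_zero)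
  have hv : Summable (qGaussMajorant ‖q ^ 2‖ ‖q ^ 2‖ ‖a‖ ‖b‖ (q ^ 2)
      fun k => 1 - ‖q ^ 2‖ ^ (k + 1)) :=
    summable_qGaussMajorant hp (by rwa [norm_mul] at hab) (norm_nonneg _) (norm_nonneg _)
      (norm_nonneg _) (norm_nonneg _) hδ (by
        simpa using ((tendsto_add_atTop_iff_nat 1).2
          (tendsto_pow_atTop_nhds_zero_of_lt_one (norm_nonneg _) hp)).const_sub 1)
  -- Nonnegativity of the majorant follows from its bounding the q-Gauss term with all four
  -- parameters 0.
  refine .of_norm_bounded (hu.mul_of_nonneg hv (fun _ => norm_nonneg _) fun m =>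
    (norm_nonneg _).trans (norm_qGaussTerm_le (x := 0) (y := 0) (a := 0) (b := 0) hp ?_ ?_ ?_ ?_
      hδ ?_ m)) fun ⟨r, m⟩ => ?_
  · simp
  · simp
  · simp
  · simp
  · intro k
    simp
  · rw [baileySummand_eq, norm_mul]
    have hx : ‖q ^ 2 * (q ^ 2) ^ r‖ ≤ ‖q ^ 2‖ := by
      rw [norm_mul, norm_pow _ r]
      exact mul_le_of_le_one_right (norm_nonneg _) (pow_le_one₀ (norm_nonneg _) hp.le)
    refine mul_le_mul_of_nonneg_left (norm_qGaussTerm_le hp hx hx le_rfl le_rfl hδ ?_ m)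
      (norm_nonneg _)
    intro k
    -- With x = p^{r+1} one has |x² p^k| ≤ |p|^{k+1}, which keeps the denominators away from 0
    -- uniformly in r.
    refine le_trans ?_ (norm_sub_norm_le _ _)
    rw [norm_one, norm_mul, norm_mul (q ^ 2 * _), norm_pow _ k, pow_succ']
    refine sub_le_sub_left (mul_le_mul_of_nonneg_right ?_ (by positivity)) 1
    exact (mul_le_of_le_one_left (norm_nonneg _) (hx.trans hp.le)).trans hx

/-! ### The two evaluations of the double series -/

theorem sum_antidiagonal_baileySummand {q : ℂ} (hq0 : q ≠ 0) (hq : ‖q‖ < 1) (a b : ℂ) (n : ℕ) :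
    ∑ x ∈ antidiagonal n, baileySummand q a b x
      = powMulQPoch (q ^ 2) a (q ^ 2) n * powMulQPoch (q ^ 2) b (q ^ 2) n
          * qPoch q (q ^ 2) n / (qPoch (q ^ 2) (q ^ 2) n * qPoch (-q) q (2 * n)) := by
  rw [mul_div_assoc, ← sum_partialTheta_mul_baileyKernel hq0 hq,
    Nat.sum_antidiagonal_eq_sum_range_succ_mk, mul_sum]
  refine sum_congr rfl fun r hr => ?_
  have : r + (n - r) = n := by have := mem_range.1 hr; omega
  simp only [baileySummand, this, heckeTerm]
  ring

/-- This is the q-Gauss sum at x = y = p^{r+1}; splitting off initial factors of the infinite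
products makes the prefactors independent of r. -/
theorem tsum_baileySummand_fiber {q a b : ℂ} (hq : ‖q‖ < 1) (hab : ‖a * b‖ < 1)
    (ha : ∀ k, 1 - q ^ 2 * a * (q ^ 2) ^ k ≠ 0) (hb : ∀ k, 1 - q ^ 2 * b * (q ^ 2) ^ k ≠ 0)
    (r : ℕ) :
    qPochInf (q ^ 2) (q ^ 2) * qPochInf (a * b) (q ^ 2) * ∑' m, baileySummand q a b (r, m)
      = qPochInf (q ^ 2 * a) (q ^ 2) * qPochInf (q ^ 2 * b) (q ^ 2)
        * (heckeTerm q r * (powMulQPoch (q ^ 2) a (q ^ 2) r * powMulQPoch (q ^ 2) b (q ^ 2) r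
          * (qPoch (q ^ 2 * a) (q ^ 2) r * qPoch (q ^ 2 * b) (q ^ 2) r)⁻¹)) := by
  have hp := norm_sq_lt_one hq
  have hx : ‖q ^ 2 * (q ^ 2) ^ (2 * r + 1)‖ < 1 := norm_mul_pow_lt_one hp hp _
  have e : q ^ 2 * (q ^ 2) ^ r * (q ^ 2 * (q ^ 2) ^ r) = q ^ 2 * (q ^ 2) ^ (2 * r + 1) := by ring
  have h := qGauss_sum (x := q ^ 2 * (q ^ 2) ^ r) (y := q ^ 2 * (q ^ 2) ^ r) hp hab (fun k => by
    rw [e]; exact one_sub_ne_zero_of_norm_lt_one (norm_mul_pow_lt_one hp hx k))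
  rw [e, mul_right_comm _ _ a, mul_right_comm _ _ b] at h
  simp only [baileySummand_eq, tsum_mul_left]
  rw [← qPoch_mul_qPochInf hp (q ^ 2) (2 * r + 1), ← qPoch_mul_qPochInf hp (q ^ 2 * a) r,
    ← qPoch_mul_qPochInf hp (q ^ 2 * b) r]
  have h1 := qPoch_self_ne_zero hp (2 * r + 1)
  have h2 := qPoch_ne_zero (n := r) ha
  have h3 := qPoch_ne_zero (n := r) hb
  field_simp
  linear_combination heckeTerm q r * powMulQPoch (q ^ 2) a (q ^ 2) r
    * powMulQPoch (q ^ 2) b (q ^ 2) r * h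

theorem summable_baileySide {q : ℂ} (hq0 : q ≠ 0) (hq : ‖q‖ < 1) {a b : ℂ} (hab : ‖a * b‖ < 1) :
    Summable fun n => powMulQPoch (q ^ 2) a (q ^ 2) n * powMulQPoch (q ^ 2) b (q ^ 2) n
          * qPoch q (q ^ 2) n / (qPoch (q ^ 2) (q ^ 2) n * qPoch (-q) q (2 * n)) := by
  simpa only [sum_antidiagonal_baileySummand hq0 hq] using
    (summable_baileySummand hq0 hq hab).hasSum_sum_antidiagonal.summable

theorem summable_heckeSide {q : ℂ} (hq0 : q ≠ 0) (hq : ‖q‖ < 1) {a b : ℂ} (hab : ‖a * b‖ < 1)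
    (ha : ∀ k, 1 - q ^ 2 * a * (q ^ 2) ^ k ≠ 0) (hb : ∀ k, 1 - q ^ 2 * b * (q ^ 2) ^ k ≠ 0) :
    Summable fun r => heckeTerm q r
      * (powMulQPoch (q ^ 2) a (q ^ 2) r * powMulQPoch (q ^ 2) b (q ^ 2) r
          * (qPoch (q ^ 2 * a) (q ^ 2) r * qPoch (q ^ 2 * b) (q ^ 2) r)⁻¹) := by
  have hp := norm_sq_lt_one hq
  exact summable_heckeTerm_mul hq0 hq hab (((tendsto_qPoch hp _).mul (tendsto_qPoch hp _)).inv₀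
    (mul_ne_zero (qPochInf_ne_zero hp ha) (qPochInf_ne_zero hp hb)))

/-- The transformation formula, with the inner sum over `j` written as a partial theta sum. -/
theorem qPochInf_div_mul_tsum_baileySide {q : ℂ} (hq0 : q ≠ 0) (hq : ‖q‖ < 1) {a b : ℂ}
    (hab : ‖a * b‖ < 1)
    (ha : ∀ k, 1 - q ^ 2 * a * (q ^ 2) ^ k ≠ 0) (hb : ∀ k, 1 - q ^ 2 * b * (q ^ 2) ^ k ≠ 0) :
    (qPochInf (q ^ 2) (q ^ 2) * qPochInf (a * b) (q ^ 2))
        / (qPochInf (q ^ 2 * a) (q ^ 2) * qPochInf (q ^ 2 * b) (q ^ 2))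
      * ∑' n, powMulQPoch (q ^ 2) a (q ^ 2) n * powMulQPoch (q ^ 2) b (q ^ 2) n
          * qPoch q (q ^ 2) n / (qPoch (q ^ 2) (q ^ 2) n * qPoch (-q) q (2 * n))
      = ∑' r, heckeTerm q r
        * (powMulQPoch (q ^ 2) a (q ^ 2) r * powMulQPoch (q ^ 2) b (q ^ 2) r
          * (qPoch (q ^ 2 * a) (q ^ 2) r * qPoch (q ^ 2 * b) (q ^ 2) r)⁻¹) := by
  have hp := norm_sq_lt_one hq
  have hs := summable_baileySummand hq0 hq hab
  have h1 := hs.hasSum_sum_antidiagonal.tsum_eq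
  simp only [sum_antidiagonal_baileySummand hq0 hq] at h1
  rw [h1, hs.tsum_prod, div_mul_eq_mul_div, div_eq_iff (mul_ne_zero (qPochInf_ne_zero hp ha)
    (qPochInf_ne_zero hp hb)), ← tsum_mul_left, ← tsum_mul_right]
  exact tsum_congr fun r => (tsum_baileySummand_fiber hq hab ha hb r).trans (mul_comm _ _)

/-! ### Passage to the stated form and the case a = b = 0 -/

theorem sum_Icc_eq_heckeTerm_mul {q : ℂ} (hq0 : q ≠ 0) (n : ℕ) (c : ℂ) :
    ∑ j ∈ Icc (-(n : ℤ)) (n : ℤ),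
        (-1 : ℂ) ^ j * (1 - q ^ (4 * n + 2)) * q ^ (2 * (n : ℤ) ^ 2 - j ^ 2) * c
      = heckeTerm q n * c := by
  rw [← sum_mul, heckeTerm, partialTheta, mul_sum]
  congr 1
  refine sum_congr rfl fun j _ => ?_
  have h : q ^ (2 * (n : ℤ) ^ 2) = (q ^ 2) ^ n ^ 2 := by
    rw [← pow_mul]; exact_mod_cast zpow_natCast q (2 * n ^ 2)
  rw [sub_eq_add_neg (2 * (n : ℤ) ^ 2), zpow_add₀ hq0, h]
  ring

theorem sum_Icc_mul_pow {q : ℂ} (hq0 : q ≠ 0) (n : ℕ) :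
    ∑ j ∈ Icc (-(n : ℤ)) (n : ℤ),
        (-1 : ℂ) ^ j * (1 - q ^ (4 * n + 2)) * q ^ (2 * (n : ℤ) ^ 2 - j ^ 2)
          * q ^ (2 * n ^ 2 + 2 * n)
      = ∑ j ∈ Icc (-(n : ℤ)) (n : ℤ),
        (-1 : ℂ) ^ j * (1 - q ^ (4 * n + 2)) * q ^ (4 * (n : ℤ) ^ 2 + 2 * (n : ℤ) - j ^ 2) := by
  refine sum_congr rfl fun j _ => ?_
  have h : q ^ (2 * n ^ 2 + 2 * n) = q ^ (2 * (n : ℤ) ^ 2 + 2 * (n : ℤ)) := by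
    exact_mod_cast (zpow_natCast q (2 * n ^ 2 + 2 * n)).symm
  rw [mul_assoc, h, ← zpow_add₀ hq0]
  congr 2
  ring

/-- Each factor is (-1)^n q^{n(n+1)}, and the signs cancel in the square. -/
theorem powMulQPoch_zero_mul_self (q : ℂ) (n : ℕ) :
    powMulQPoch (q ^ 2) 0 (q ^ 2) n * powMulQPoch (q ^ 2) 0 (q ^ 2) n
      = q ^ (2 * n ^ 2 + 2 * n) := by
  induction n with
  | zero => simp [powMulQPoch]
  | succ n ih =>
    rw [powMulQPoch_succ, mul_mul_mul_comm, ih]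
    ring

theorem qPoch_zero_left (q : ℂ) (n : ℕ) : qPoch 0 q n = 1 := by simp [qPoch]

theorem mainTheorem10 (q : ℝ) (hq0 : 0 < q) (hq1 : q < 1) :
    -- the transformation formula for nonzero `a`, `b`
    (∀ a b : ℂ, a ≠ 0 → b ≠ 0 → ‖a * b‖ < 1 →
      (∀ k : ℕ, (q : ℂ) ^ (2 * k + 2) * a ≠ 1) → (∀ k : ℕ, (q : ℂ) ^ (2 * k + 2) * b ≠ 1) →
      (Summable fun n : ℕ =>
        qPoch ((q : ℂ) ^ 2 / a) ((q : ℂ) ^ 2) n * qPoch ((q : ℂ) ^ 2 / b) ((q : ℂ) ^ 2) n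
          * qPoch (q : ℂ) ((q : ℂ) ^ 2) n * (a * b) ^ n
          / (qPoch ((q : ℂ) ^ 2) ((q : ℂ) ^ 2) n * qPoch (-(q : ℂ)) (q : ℂ) (2 * n))) ∧
      (Summable fun n : ℕ => ∑ j ∈ Finset.Icc (-(n : ℤ)) (n : ℤ),
        (-1 : ℂ) ^ j * (1 - (q : ℂ) ^ (4 * n + 2)) * (q : ℂ) ^ (2 * (n : ℤ) ^ 2 - j ^ 2)
          * (qPoch ((q : ℂ) ^ 2 / a) ((q : ℂ) ^ 2) n * qPoch ((q : ℂ) ^ 2 / b) ((q : ℂ) ^ 2) n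
              * (a * b) ^ n
            / (qPoch ((q : ℂ) ^ 2 * a) ((q : ℂ) ^ 2) n
              * qPoch ((q : ℂ) ^ 2 * b) ((q : ℂ) ^ 2) n))) ∧
      (qPochInf ((q : ℂ) ^ 2) ((q : ℂ) ^ 2) * qPochInf (a * b) ((q : ℂ) ^ 2))
          / (qPochInf ((q : ℂ) ^ 2 * a) ((q : ℂ) ^ 2) * qPochInf ((q : ℂ) ^ 2 * b) ((q : ℂ) ^ 2))
        * ∑' n : ℕ,
          qPoch ((q : ℂ) ^ 2 / a) ((q : ℂ) ^ 2) n * qPoch ((q : ℂ) ^ 2 / b) ((q : ℂ) ^ 2) n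
            * qPoch (q : ℂ) ((q : ℂ) ^ 2) n * (a * b) ^ n
            / (qPoch ((q : ℂ) ^ 2) ((q : ℂ) ^ 2) n * qPoch (-(q : ℂ)) (q : ℂ) (2 * n))
      = ∑' n : ℕ, ∑ j ∈ Finset.Icc (-(n : ℤ)) (n : ℤ),
        (-1 : ℂ) ^ j * (1 - (q : ℂ) ^ (4 * n + 2)) * (q : ℂ) ^ (2 * (n : ℤ) ^ 2 - j ^ 2)
          * (qPoch ((q : ℂ) ^ 2 / a) ((q : ℂ) ^ 2) n * qPoch ((q : ℂ) ^ 2 / b) ((q : ℂ) ^ 2) n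
              * (a * b) ^ n
            / (qPoch ((q : ℂ) ^ 2 * a) ((q : ℂ) ^ 2) n
              * qPoch ((q : ℂ) ^ 2 * b) ((q : ℂ) ^ 2) n))) ∧
    -- the same formula for all `a`, `b`, where `a = 0` or `b = 0` is allowed and
    -- `a^n (q²/a; q²)_n`, `b^n (q²/b; q²)_n` are read as polynomials in `a`, `b`
    (∀ a b : ℂ, ‖a * b‖ < 1 →
      (∀ k : ℕ, (q : ℂ) ^ (2 * k + 2) * a ≠ 1) → (∀ k : ℕ, (q : ℂ) ^ (2 * k + 2) * b ≠ 1) →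
      (Summable fun n : ℕ =>
        powMulQPoch ((q : ℂ) ^ 2) a ((q : ℂ) ^ 2) n * powMulQPoch ((q : ℂ) ^ 2) b ((q : ℂ) ^ 2) n
          * qPoch (q : ℂ) ((q : ℂ) ^ 2) n
          / (qPoch ((q : ℂ) ^ 2) ((q : ℂ) ^ 2) n * qPoch (-(q : ℂ)) (q : ℂ) (2 * n))) ∧
      (Summable fun n : ℕ => ∑ j ∈ Finset.Icc (-(n : ℤ)) (n : ℤ),
        (-1 : ℂ) ^ j * (1 - (q : ℂ) ^ (4 * n + 2)) * (q : ℂ) ^ (2 * (n : ℤ) ^ 2 - j ^ 2)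
          * (powMulQPoch ((q : ℂ) ^ 2) a ((q : ℂ) ^ 2) n
              * powMulQPoch ((q : ℂ) ^ 2) b ((q : ℂ) ^ 2) n
            / (qPoch ((q : ℂ) ^ 2 * a) ((q : ℂ) ^ 2) n
              * qPoch ((q : ℂ) ^ 2 * b) ((q : ℂ) ^ 2) n))) ∧
      (qPochInf ((q : ℂ) ^ 2) ((q : ℂ) ^ 2) * qPochInf (a * b) ((q : ℂ) ^ 2))
          / (qPochInf ((q : ℂ) ^ 2 * a) ((q : ℂ) ^ 2) * qPochInf ((q : ℂ) ^ 2 * b) ((q : ℂ) ^ 2))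
        * ∑' n : ℕ,
          powMulQPoch ((q : ℂ) ^ 2) a ((q : ℂ) ^ 2) n * powMulQPoch ((q : ℂ) ^ 2) b ((q : ℂ) ^ 2) n
            * qPoch (q : ℂ) ((q : ℂ) ^ 2) n
            / (qPoch ((q : ℂ) ^ 2) ((q : ℂ) ^ 2) n * qPoch (-(q : ℂ)) (q : ℂ) (2 * n))
      = ∑' n : ℕ, ∑ j ∈ Finset.Icc (-(n : ℤ)) (n : ℤ),
        (-1 : ℂ) ^ j * (1 - (q : ℂ) ^ (4 * n + 2)) * (q : ℂ) ^ (2 * (n : ℤ) ^ 2 - j ^ 2)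
          * (powMulQPoch ((q : ℂ) ^ 2) a ((q : ℂ) ^ 2) n
              * powMulQPoch ((q : ℂ) ^ 2) b ((q : ℂ) ^ 2) n
            / (qPoch ((q : ℂ) ^ 2 * a) ((q : ℂ) ^ 2) n
              * qPoch ((q : ℂ) ^ 2 * b) ((q : ℂ) ^ 2) n))) ∧
    -- the special case `a = b = 0`: Andrews' identity
    ((Summable fun n : ℕ =>
        qPoch (q : ℂ) ((q : ℂ) ^ 2) n * (q : ℂ) ^ (2 * n ^ 2 + 2 * n)
          / (qPoch ((q : ℂ) ^ 2) ((q : ℂ) ^ 2) n * qPoch (-(q : ℂ)) (q : ℂ) (2 * n))) ∧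
      (Summable fun n : ℕ => ∑ j ∈ Finset.Icc (-(n : ℤ)) (n : ℤ),
        (-1 : ℂ) ^ j * (1 - (q : ℂ) ^ (4 * n + 2))
          * (q : ℂ) ^ (4 * (n : ℤ) ^ 2 + 2 * (n : ℤ) - j ^ 2)) ∧
      ∑' n : ℕ,
          qPoch (q : ℂ) ((q : ℂ) ^ 2) n * (q : ℂ) ^ (2 * n ^ 2 + 2 * n)
            / (qPoch ((q : ℂ) ^ 2) ((q : ℂ) ^ 2) n * qPoch (-(q : ℂ)) (q : ℂ) (2 * n))
      = 1 / qPochInf ((q : ℂ) ^ 2) ((q : ℂ) ^ 2)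
        * ∑' n : ℕ, ∑ j ∈ Finset.Icc (-(n : ℤ)) (n : ℤ),
          (-1 : ℂ) ^ j * (1 - (q : ℂ) ^ (4 * n + 2))
            * (q : ℂ) ^ (4 * (n : ℤ) ^ 2 + 2 * (n : ℤ) - j ^ 2)) := by
  have hq0' : (q : ℂ) ≠ 0 := Complex.ofReal_ne_zero.2 hq0.ne'
  have hq1' : ‖(q : ℂ)‖ < 1 := by simpa [abs_of_pos hq0] using hq1
  have hne : ∀ a : ℂ, (∀ k : ℕ, (q : ℂ) ^ (2 * k + 2) * a ≠ 1) →
      ∀ k, 1 - (q : ℂ) ^ 2 * a * ((q : ℂ) ^ 2) ^ k ≠ 0 := fun a ha k h =>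
    ha k ((sub_eq_zero.1 h).trans (by ring)).symm
  have general : (∀ a b : ℂ, ‖a * b‖ < 1 →
      (∀ k : ℕ, (q : ℂ) ^ (2 * k + 2) * a ≠ 1) → (∀ k : ℕ, (q : ℂ) ^ (2 * k + 2) * b ≠ 1) →
      (Summable fun n : ℕ =>
        powMulQPoch ((q : ℂ) ^ 2) a ((q : ℂ) ^ 2) n * powMulQPoch ((q : ℂ) ^ 2) b ((q : ℂ) ^ 2) n
          * qPoch (q : ℂ) ((q : ℂ) ^ 2) n
          / (qPoch ((q : ℂ) ^ 2) ((q : ℂ) ^ 2) n * qPoch (-(q : ℂ)) (q : ℂ) (2 * n))) ∧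
      (Summable fun n : ℕ => ∑ j ∈ Finset.Icc (-(n : ℤ)) (n : ℤ),
        (-1 : ℂ) ^ j * (1 - (q : ℂ) ^ (4 * n + 2)) * (q : ℂ) ^ (2 * (n : ℤ) ^ 2 - j ^ 2)
          * (powMulQPoch ((q : ℂ) ^ 2) a ((q : ℂ) ^ 2) n
              * powMulQPoch ((q : ℂ) ^ 2) b ((q : ℂ) ^ 2) n
            / (qPoch ((q : ℂ) ^ 2 * a) ((q : ℂ) ^ 2) n
              * qPoch ((q : ℂ) ^ 2 * b) ((q : ℂ) ^ 2) n))) ∧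
      (qPochInf ((q : ℂ) ^ 2) ((q : ℂ) ^ 2) * qPochInf (a * b) ((q : ℂ) ^ 2))
          / (qPochInf ((q : ℂ) ^ 2 * a) ((q : ℂ) ^ 2) * qPochInf ((q : ℂ) ^ 2 * b) ((q : ℂ) ^ 2))
        * ∑' n : ℕ,
          powMulQPoch ((q : ℂ) ^ 2) a ((q : ℂ) ^ 2) n * powMulQPoch ((q : ℂ) ^ 2) b ((q : ℂ) ^ 2) n
            * qPoch (q : ℂ) ((q : ℂ) ^ 2) n
            / (qPoch ((q : ℂ) ^ 2) ((q : ℂ) ^ 2) n * qPoch (-(q : ℂ)) (q : ℂ) (2 * n))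
      = ∑' n : ℕ, ∑ j ∈ Finset.Icc (-(n : ℤ)) (n : ℤ),
        (-1 : ℂ) ^ j * (1 - (q : ℂ) ^ (4 * n + 2)) * (q : ℂ) ^ (2 * (n : ℤ) ^ 2 - j ^ 2)
          * (powMulQPoch ((q : ℂ) ^ 2) a ((q : ℂ) ^ 2) n
              * powMulQPoch ((q : ℂ) ^ 2) b ((q : ℂ) ^ 2) n
            / (qPoch ((q : ℂ) ^ 2 * a) ((q : ℂ) ^ 2) n
              * qPoch ((q : ℂ) ^ 2 * b) ((q : ℂ) ^ 2) n))) := by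
    intro a b hab ha hb
    simp only [sum_Icc_eq_heckeTerm_mul hq0', div_eq_mul_inv (powMulQPoch _ _ _ _ * powMulQPoch _ _ _ _)]
    exact ⟨summable_baileySide hq0' hq1' hab, summable_heckeSide hq0' hq1' hab (hne a ha) (hne b hb),
      qPochInf_div_mul_tsum_baileySide hq0' hq1' hab (hne a ha) (hne b hb)⟩
  refine ⟨fun a b ha0 hb0 hab ha hb => ?_, general, ?_⟩
  · have h := general a b hab ha hb
    have e : ∀ n, powMulQPoch ((q : ℂ) ^ 2) a ((q : ℂ) ^ 2) n
          * powMulQPoch ((q : ℂ) ^ 2) b ((q : ℂ) ^ 2) n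
        = qPoch ((q : ℂ) ^ 2 / a) ((q : ℂ) ^ 2) n * qPoch ((q : ℂ) ^ 2 / b) ((q : ℂ) ^ 2) n
          * (a * b) ^ n := fun n => by
      rw [powMulQPoch_eq _ _ _ ha0, powMulQPoch_eq _ _ _ hb0]; ring
    simp only [e, mul_right_comm _ ((a * b) ^ _) (qPoch (q : ℂ) _ _)] at h
    exact h
  · have h := general 0 0 (by simp) (by simp) (by simp)
    simp only [powMulQPoch_zero_mul_self, mul_zero, qPochInf_zero, mul_one, qPoch_zero_left, div_one,
      sum_Icc_mul_pow hq0', mul_comm (_ ^ _) (qPoch (q : ℂ) _ _)] at h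
    obtain ⟨h1, h2, h3⟩ := h
    refine ⟨h1, h2, ?_⟩
    have hp := norm_sq_lt_one hq1'
    rw [← h3, ← mul_assoc, one_div_mul_cancel, one_mul]
    exact qPochInf_ne_zero hp fun k => one_sub_ne_zero_of_norm_lt_one (norm_mul_pow_lt_one hp hp k)
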